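/- Let $\Lambda\subset\mathbb C$ be open and connected, let $X,Y$ be complex Banach spaces, and let $A:\Lambda\to\mathcal L(X,Y)$ be a holomorphic Fredholm operator-valued function, i.e. $A$ is differentiable in the operator norm at every point of $\Lambda$, $A(k)$ is a Fredholm operator for every $k\in\Lambda$, and $A(k)$ is invertible for at least one $k\in\Lambda$. A point $k\in\Lambda$ is an eigenvalue of such a function if $A(k)$ is not injective, and its geometric multiplicity is $\dim N(A(k))$, where $N$ denotes the null space. A Jordan chain of $A$ at $k$ of length $n\ge 1$ is a tuple $(\varphi_0,\dots,\varphi_{n-1})$ in $X$ with $\varphi_0\neq0$ and $\sum_{l=0}^{j}\frac1{l!}A^{(l)}(k)\varphi_{j-l}=0$ for $j=0,\dots,n-1$. The algebraic multiplicity of an eigenvalue is the sum of its partial multiplicities, i.e. the total length of a canonical system of Jordan chains: chains whose leading vectors form a basis of $N(A(k))$, each chain in turn being of the largest length possible among the Jordan chains whose leading vector is not in the span of the previously chosen leading vectors. (If the geometric multiplicity is $1$, it is the maximal length of a Jordan chain.) Let $k_0\in\Lambda$ be an eigenvalue of $A$ of geometric multiplicity $1$, let $p$ be its algebraic multiplicity,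 and let $B\in\mathcal L(X,Y)$ be nonzero. Then there exist open neighborhoods $V$ of $0\in\mathbb C$ and $\Lambda_0\subset\Lambda$ of $k_0$ and holomorphic functions $c_0,\dots,c_{p-1}:V\to\mathbb C$ such that 1. $c_0(0)=c_1(0)=\dots=c_{p-1}(0)=0$; 2. for every $\varepsilon\in V$, the polynomial $$k\mapsto W(\varepsilon,k):=(k-k_0)^p+c_{p-1}(\varepsilon)(k-k_0)^{p-1}+\dots+c_1(\varepsilon)(k-k_0)+c_0(\varepsilon)$$ has $p$ zeros, counted with multiplicity, in $\Lambda_0$; 3. for every $\varepsilon\in V$ and $k\in\Lambda_0$, the point $k$ is an eigenvalue of $A+\varepsilon B$ if and only if $W(\varepsilon,k)=0$. -/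

import Mathlib

namespace HolFredholm

variable {X Y : Type*} [NormedAddCommGroup X] [NormedSpace ℂ X]
  [NormedAddCommGroup Y] [NormedSpace ℂ Y]

/-- Holomorphic Fredholm operator-valued function on `Λ ⊆ ℂ` (a map `Λ → 𝓛(X, Y)` is represented by
a total map of which only the values on `Λ` matter): it is differentiable in the operator norm at
every point of `Λ`, every value is a Fredholm operator, and at least one value is invertible. -/
structure IsHolomorphicFredholm (Λ : Set ℂ) (A : ℂ → X →L[ℂ] Y) : Prop where
  holomorphic : ∀ k ∈ Λ, DifferentiableAt ℂ A k
  fredholm : ∀ k ∈ Λ, (A k).IsFredholm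
  exists_invertible : ∃ k ∈ Λ, (A k).IsInvertible

/-- `k` is an eigenvalue of `A : Λ → 𝓛(X, Y)`: `k ∈ Λ` and `A k` is not injective. -/
def IsEigenvalue (Λ : Set ℂ) (A : ℂ → X →L[ℂ] Y) (k : ℂ) : Prop :=
  k ∈ Λ ∧ ¬ Function.Injective (A k)

/-- The geometric multiplicity: the dimension of the eigenspace `N(A(k))`. -/
noncomputable def geometricMultiplicity (A : ℂ → X →L[ℂ] Y) (k : ℂ) : ℕ :=
  Module.finrank ℂ (LinearMap.ker (A k).toLinearMap)

/-- `(φ 0, …, φ (n - 1))` is a Jordan chain of `A` at `k` of length `n ≥ 1`: `φ 0 ≠ 0` and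
`∑_{l = 0}^{j} (1 / l!) A⁽ˡ⁾(k) φ (j - l) = 0` for `j = 0, …, n - 1`. Only the values of `φ` at
`0, …, n - 1` matter. -/
def IsJordanChain (A : ℂ → X →L[ℂ] Y) (k : ℂ) (n : ℕ) (φ : ℕ → X) : Prop :=
  1 ≤ n ∧ φ 0 ≠ 0 ∧ ∀ j < n,
    ∑ l ∈ Finset.range (j + 1), ((1 : ℂ) / (l.factorial : ℂ)) • (iteratedDeriv l A k) (φ (j - l)) = 0

/-- A canonical system of Jordan chains of `A` at `k`: `m` Jordan chains `φ i` of lengths `n i`,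
whose leading vectors `φ i 0` form a basis of the eigenspace `N(A(k))`, and which are chosen
successively of maximal length: no Jordan chain whose leading vector lies outside the span of
`φ 0 0, …, φ (i - 1) 0` is longer than `n i`. The `n i` are the partial multiplicities. -/
structure IsCanonicalSystem (A : ℂ → X →L[ℂ] Y) (k : ℂ) (m : ℕ)
    (n : Fin m → ℕ) (φ : Fin m → ℕ → X) : Prop where
  chain : ∀ i, IsJordanChain A k (n i) (φ i)
  linearIndependent : LinearIndependent ℂ (fun i => φ i 0)
  span_eq : Submodule.span ℂ (Set.range fun i => φ i 0) = LinearMap.ker (A k).toLinearMap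
  maximal : ∀ (i : Fin m) (N : ℕ) (ψ : ℕ → X), IsJordanChain A k N ψ →
    ψ 0 ∉ Submodule.span ℂ ((fun j => φ j 0) '' {j | j < i}) → N ≤ n i

/-- The algebraic multiplicity: the sum of the partial multiplicities, that is, the total length of
a canonical system of Jordan chains. This total does not depend on the system; the infimum
only serves to select the common value. -/
noncomputable def algebraicMultiplicity (A : ℂ → X →L[ℂ] Y) (k : ℂ) : ℕ :=
  sInf {p : ℕ | ∃ (m : ℕ) (n : Fin m → ℕ) (φ : Fin m → ℕ → X),
    IsCanonicalSystem A k m n φ ∧ p = ∑ i, n i}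

/-- The polynomial `(k - k₀)^p + c_{p-1} (k - k₀)^{p-1} + … + c₁ (k - k₀) + c₀` in `k`. -/
noncomputable def weierstrassPolynomial (k₀ : ℂ) (p : ℕ) (c : Fin p → ℂ) : Polynomial ℂ :=
  (Polynomial.X - Polynomial.C k₀) ^ p +
    ∑ j : Fin p, Polynomial.C (c j) * (Polynomial.X - Polynomial.C k₀) ^ (j : ℕ)

open Classical in
/-- The number of zeros of a (nonzero) polynomial in a set, counted with multiplicity. -/
noncomputable def zerosIn (P : Polynomial ℂ) (S : Set ℂ) : ℕ :=
  (P.roots.filter (fun k => k ∈ S)).card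

end HolFredholm

/-!
Perturbation of an eigenvalue of geometric multiplicity one is reduced to the zeros of a scalar
holomorphic function of two variables, to which Weierstrass preparation applies.

**Reduction to a scalar function.** A Fredholm function on a connected set with one invertible value
has index zero throughout. This is phrased without the index: every `A k` is invertible up to finite
rank (`IsHolomorphicFredholm.isInvertibleModFinite`), a condition that is open among all operators
and closed among Fredholm ones. If the kernel of `A k₀` is one-dimensional, then
`M = A k₀ + f ⊗ y` is invertible for a suitable functional `f` and vector `y`. For `(ε, k)` near
`(0, k₀)` the operator `M (ε, k) = A k + ε B + f ⊗ y` is still invertible, and `A k + ε B` fails to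
be injective exactly when `G (ε, k) = 1 - f (M (ε, k)⁻¹ y)` vanishes
(`not_injective_iff_of_isInvertible_add_smulRight`).

**The order of `G (0, ·)` is the algebraic multiplicity.** Jordan chains are the Taylor coefficients
of root functions `u`, for which `A u` vanishes to high order. If `A u` vanishes to order `n`,
applying `f ∘ M⁻¹` shows that `f (u) G` does, and `f (u k₀) ≠ 0`. Conversely `u = M⁻¹ y`
satisfies `A u = G y`. Hence `algebraicMultiplicity_eq_of_analyticOrderAt_eq`. The order is
finite since eigenvalues are isolated: locally, invertibility of `A` is the nonvanishing of a
holomorphic determinant, and `Λ` is connected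
(`IsHolomorphicFredholm.eventually_isInvertible`).

**Weierstrass preparation.** On a small circle about `k₀` the function `G (ε, ·)` has no zeros. The
power sums of its zeros inside are contour integrals of `(ζ - k₀) ^ m` against the logarithmic
derivative, hence holomorphic in `ε`. The zeroth one counts the zeros, so it is locally constant,
equal to `p`. By Newton's identities the elementary symmetric functions of the zeros, which are up
to sign the coefficients of the polynomial with these zeros, are holomorphic as well
(`exists_weierstrassPolynomial`).
-/

namespace HolFredholm

open Filter Topology Set Metric

/-! ### Index zero: invertibility up to finite rank -/

section Operators

variable {X Y : Type*} [NormedAddCommGroup X] [NormedSpace ℂ X]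
  [NormedAddCommGroup Y] [NormedSpace ℂ Y]

lemma isOpen_isInvertible [CompleteSpace X] : IsOpen {T : X →L[ℂ] Y | T.IsInvertible} :=
  ContinuousLinearEquiv.isOpen

/-- `T` is invertible up to a finite rank operator; for Fredholm operators this expresses
that the index vanishes. -/
def IsInvertibleModFinite (T : X →L[ℂ] Y) : Prop :=
  ∃ Q : X →L[ℂ] Y, Q.IsInvertible ∧ (T - Q).toLinearMap.HasFiniteRange

lemma isOpen_isInvertibleModFinite [CompleteSpace X] :
    IsOpen {T : X →L[ℂ] Y | IsInvertibleModFinite T} := by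
  rw [isOpen_iff_mem_nhds]
  rintro T ⟨Q, hQ, hF⟩
  have hc : Continuous fun S : X →L[ℂ] Y => Q + (S - T) := by fun_prop
  have : ∀ᶠ S in 𝓝 T, (Q + (S - T)).IsInvertible := by
    refine hc.continuousAt.eventually (isOpen_isInvertible.mem_nhds ?_)
    simpa using hQ
  filter_upwards [this] with S hS
  refine ⟨_, hS, ?_⟩
  convert hF using 2
  abel

/-- Among Fredholm operators, those of index zero form a closed set. The index is not needed:
if `S` is a quasi-inverse of `T` and `R` near `T` is invertible up to finite rank, then `S ∘ R` is
close to `S ∘ T`, so `S`, and with it `T`, is invertible up to finite rank. -/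
lemma IsInvertibleModFinite.of_mem_closure [CompleteSpace X] {T : X →L[ℂ] Y} (hT : T.IsFredholm)
    (h : T ∈ closure {T : X →L[ℂ] Y | IsInvertibleModFinite T}) : IsInvertibleModFinite T := by
  obtain ⟨S, hS, -⟩ := hT.exists_isQuasiInverse
  have hST : (S.toLinearMap ∘ₗ T.toLinearMap - LinearMap.id).HasFiniteRange :=
    LinearMap.FiniteRangeSetoid.equiv_iff_hasFiniteRange.1 hS
  have hc : Continuous fun R : X →L[ℂ] Y => ContinuousLinearMap.id ℂ X + S ∘L (R - T) := by
    fun_prop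
  have hopen :
      {R : X →L[ℂ] Y | (ContinuousLinearMap.id ℂ X + S ∘L (R - T)).IsInvertible} ∈ 𝓝 T := by
    refine hc.continuousAt.preimage_mem_nhds (isOpen_isInvertible.mem_nhds ?_)
    simpa using ContinuousLinearMap.isInvertible_equiv (f := ContinuousLinearEquiv.refl ℂ X)
  obtain ⟨R, hR, Q, hQ, hF⟩ := mem_closure_iff_nhds.1 h _ hopen
  set E : X →L[ℂ] X := ContinuousLinearMap.id ℂ X + S ∘L (R - T) with hE
  have hR : E.IsInvertible := hR
  -- `S ∘ Q` differs from `E` by a finite rank operator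
  have h1 : (S.toLinearMap ∘ₗ Q.toLinearMap - E.toLinearMap).HasFiniteRange := by
    have := hST.sub (hF.comp_left S.toLinearMap)
    have e : S.toLinearMap ∘ₗ Q.toLinearMap - E.toLinearMap =
        S.toLinearMap ∘ₗ T.toLinearMap - LinearMap.id -
          S.toLinearMap ∘ₗ (R - Q).toLinearMap := by
      ext x
      simp [hE]
      abel
    rwa [e]
  -- hence `T` differs from `Q ∘ E⁻¹` by a finite rank operator
  refine ⟨Q ∘L E.inverse, hQ.comp hR.inverse, ?_⟩
  have h2 := ((hST.comp_left (Q.toLinearMap ∘ₗ E.inverse.toLinearMap)).sub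
    ((h1.comp_right (Q.inverse.toLinearMap ∘ₗ T.toLinearMap)).comp_left
      (Q.toLinearMap ∘ₗ E.inverse.toLinearMap)))
  have e : (T - Q ∘L E.inverse).toLinearMap =
      (Q.toLinearMap ∘ₗ E.inverse.toLinearMap) ∘ₗ (S.toLinearMap ∘ₗ T.toLinearMap - LinearMap.id) -
        (Q.toLinearMap ∘ₗ E.inverse.toLinearMap) ∘ₗ (S.toLinearMap ∘ₗ Q.toLinearMap -
          E.toLinearMap) ∘ₗ (Q.inverse.toLinearMap ∘ₗ T.toLinearMap) := by
    ext x
    simp [hQ.self_apply_inverse, hR.inverse_apply_self]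
  rwa [e]

/-- Along a holomorphic Fredholm function on a connected set the index vanishes identically. -/
lemma IsHolomorphicFredholm.isInvertibleModFinite [CompleteSpace X] {Λ : Set ℂ} (hΛ : IsConnected Λ)
    {A : ℂ → X →L[ℂ] Y} (hA : IsHolomorphicFredholm Λ A) {k : ℂ} (hk : k ∈ Λ) :
    IsInvertibleModFinite (A k) := by
  have hcont : ContinuousOn A Λ := fun z hz => (hA.holomorphic z hz).continuousAt.continuousWithinAt
  have hpre : IsPreconnected (A '' Λ) := hΛ.isPreconnected.image A hcont
  obtain ⟨k₁, hk₁, hinv⟩ := hA.exists_invertible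
  have := hpre.subset_of_closure_inter_subset isOpen_isInvertibleModFinite
    ⟨A k₁, mem_image_of_mem A hk₁, A k₁, hinv, by simp⟩
    (by
      rintro _ ⟨hcl, z, hz, rfl⟩
      exact IsInvertibleModFinite.of_mem_closure (hA.fredholm z hz) hcl)
  exact this (mem_image_of_mem A hk)

/-- An injective finite rank perturbation of the identity is surjective. -/
lemma surjective_of_injective_of_hasFiniteRange {V : Type*} [AddCommGroup V] [Module ℂ V]
    {S : V →ₗ[ℂ] V} (hS : (S - LinearMap.id).HasFiniteRange) (hinj : Function.Injective S) :
    Function.Surjective S := by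
  -- `S` preserves the finite-dimensional range `W` of `S - 1`
  set W := LinearMap.range (S - LinearMap.id)
  have : FiniteDimensional ℂ W := Module.Finite.of_fg hS
  have hW : ∀ x, S x - x ∈ W := fun x => ⟨x, by simp⟩
  have hmap : ∀ x ∈ W, S x ∈ W := fun x hx => by simpa using W.add_mem (hW x) hx
  have hsurj : Function.Surjective (S.restrict hmap) :=
    LinearMap.injective_iff_surjective.1 fun a b hab =>
      Subtype.ext (hinj (by simpa [Subtype.ext_iff] using hab))
  intro y
  obtain ⟨w, hw⟩ := hsurj ⟨S y - y, hW y⟩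
  refine ⟨y - w, ?_⟩
  have : S w = S y - y := by simpa [Subtype.ext_iff] using hw
  simp [this]

/-- A finite rank perturbation of the identity with nontrivial kernel is not surjective. -/
lemma not_surjective_of_hasFiniteRange {V : Type*} [AddCommGroup V] [Module ℂ V]
    {S : V →ₗ[ℂ] V} (hS : (S - LinearMap.id).HasFiniteRange) (hinj : ¬ Function.Injective S) :
    ¬ Function.Surjective S := by
  set W := LinearMap.range (S - LinearMap.id)
  have : FiniteDimensional ℂ W := Module.Finite.of_fg hS
  have hW : ∀ x, S x - x ∈ W := fun x => ⟨x, by simp⟩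
  have hmap : ∀ x ∈ W, S x ∈ W := fun x hx => by simpa using W.add_mem (hW x) hx
  intro hsurj
  have hsurjW : Function.Surjective (S.restrict hmap) := by
    rintro ⟨y, hy⟩
    obtain ⟨x, rfl⟩ := hsurj y
    have hx : x ∈ W := by simpa using W.sub_mem hy (hW x)
    exact ⟨⟨x, hx⟩, rfl⟩
  have hinjW := LinearMap.injective_iff_surjective.2 hsurjW
  refine hinj ((injective_iff_map_eq_zero S).2 fun x hx => ?_)
  have hxW : x ∈ W := by simpa [hx] using hW x
  have := (injective_iff_map_eq_zero (S.restrict hmap)).1 hinjW ⟨x, hxW⟩ (Subtype.ext hx)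
  simpa using this

/-- An injective operator which is invertible up to finite rank is invertible. -/
lemma IsInvertibleModFinite.isInvertible [CompleteSpace X] [CompleteSpace Y] {T : X →L[ℂ] Y}
    (hT : IsInvertibleModFinite T) (hinj : Function.Injective T) : T.IsInvertible := by
  obtain ⟨Q, hQ, hF⟩ := hT
  have hS : (Q.inverse.toLinearMap ∘ₗ T.toLinearMap - LinearMap.id).HasFiniteRange := by
    convert hF.comp_left Q.inverse.toLinearMap using 1
    ext x
    simp [hQ.inverse_apply_self]
  have hsurj := surjective_of_injective_of_hasFiniteRange hS
    (hQ.inverse.injective.comp hinj)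
  have hTs : Function.Surjective T := fun y => by
    obtain ⟨x, hx⟩ := hsurj (Q.inverse y)
    exact ⟨x, hQ.inverse.injective hx⟩
  exact ⟨ContinuousLinearEquiv.ofBijective T (LinearMap.ker_eq_bot.2 hinj)
    (LinearMap.range_eq_top.2 hTs), by ext; rfl⟩

/-- An operator of index zero with one-dimensional kernel becomes invertible after adding a
suitable rank one operator. -/
lemma IsInvertibleModFinite.exists_isInvertible_add_smulRight [CompleteSpace X] [CompleteSpace Y]
    {T : X →L[ℂ] Y} (hT : IsInvertibleModFinite T)
    (hker : Module.finrank ℂ (LinearMap.ker T.toLinearMap) = 1) :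
    ∃ (f : X →L[ℂ] ℂ) (y : Y), (T + f.smulRight y).IsInvertible := by
  obtain ⟨⟨φ, hφ⟩, hφ0, hspan⟩ := finrank_eq_one_iff'.1 hker
  have hφ0 : φ ≠ 0 := fun h => hφ0 (Subtype.ext h)
  have hTφ : T φ = 0 := hφ
  obtain ⟨f, -, hf⟩ := exists_dual_vector ℂ φ (norm_ne_zero_iff.2 hφ0)
  have hfφ : f φ ≠ 0 := by rw [hf]; simpa using hφ0
  obtain ⟨Q, hQ, hF⟩ := id hT
  have hS : (Q.inverse.toLinearMap ∘ₗ T.toLinearMap - LinearMap.id).HasFiniteRange := by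
    convert hF.comp_left Q.inverse.toLinearMap using 1
    ext x
    simp [hQ.inverse_apply_self]
  -- a vector outside the range of `T` completes it to an invertible operator
  have hns := not_surjective_of_hasFiniteRange hS fun hi => hφ0 (hi (by simp [hTφ]))
  obtain ⟨y, hy⟩ : ∃ y, ∀ x, T x ≠ y := by
    by_contra! hcon
    refine hns fun x => ?_
    obtain ⟨z, hz⟩ := hcon (Q x)
    exact ⟨z, by simp [hz, hQ.inverse_apply_self]⟩
  refine ⟨f, y, IsInvertibleModFinite.isInvertible ⟨Q, hQ, ?_⟩ ?_⟩
  · have h1 : (f.smulRight y).toLinearMap.HasFiniteRange := by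
      refine (LinearMap.HasFiniteRange.of_finite_dom
        (f := LinearMap.toSpanSingleton ℂ Y y)).comp_right f.toLinearMap
    have e : (T + f.smulRight y - Q).toLinearMap =
        (T - Q).toLinearMap + (f.smulRight y).toLinearMap := by
      ext x
      simp
      abel
    rw [e]
    exact hF.add h1
  · refine (injective_iff_map_eq_zero _).2 fun x hx => ?_
    have hx : T x + f x • y = 0 := by simpa using hx
    have hfx : f x = 0 := by
      by_contra hne
      refine hy (-(f x)⁻¹ • x) ?_
      rw [map_smul, eq_neg_of_add_eq_zero_left hx]
      simp [smul_smul, hne]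
    obtain ⟨c, hc⟩ := hspan ⟨x, by simpa [hfx] using hx⟩
    have hc : c • φ = x := congrArg Subtype.val hc
    rw [← hc, map_smul, smul_eq_mul] at hfx
    rcases mul_eq_zero.1 hfx with h | h
    · rw [← hc, h, zero_smul]
    · exact absurd h hfφ

/-! ### Isolated eigenvalues and the rank one reduction -/

lemma analyticAt_inverse_clm [CompleteSpace X] [CompleteSpace Y] {E : Type*}
    [NormedAddCommGroup E] [NormedSpace ℂ E]
    {M : E → X →L[ℂ] Y} {e : E} (hM : AnalyticAt ℂ M e) (hinv : (M e).IsInvertible) :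
    AnalyticAt ℂ (fun z => (M z).inverse) e :=
  AnalyticAt.comp (g := ContinuousLinearMap.inverse)
    hinv.contDiffAt_map_inverse.analyticAt hM

/-- Near a point where a holomorphic operator function is invertible up to finite rank,
invertibility is governed by the nonvanishing of a holomorphic determinant, so it fails either
throughout a neighbourhood or at most at the point itself. -/
lemma IsInvertibleModFinite.eventually_not_injective_or_eventually_isInvertible
    [CompleteSpace X] [CompleteSpace Y] {A : ℂ → X →L[ℂ] Y} {k : ℂ} (hA : AnalyticAt ℂ A k)
    (hk : IsInvertibleModFinite (A k)) :
    (∀ᶠ z in 𝓝 k, ¬ Function.Injective (A z)) ∨ ∀ᶠ z in 𝓝[≠] k, (A z).IsInvertible := by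
  obtain ⟨Q, hQ, hF⟩ := id hk
  set F : X →L[ℂ] Y := A k - Q with hFdef
  set E := LinearMap.range F.toLinearMap
  have : FiniteDimensional ℂ E := Module.Finite.of_fg hF
  let J : E →L[ℂ] Y := E.subtypeL
  let P : X →L[ℂ] E := F.codRestrict E fun x => ⟨x, rfl⟩
  have hJP : ∀ x, J (P x) = F x := fun x => rfl
  have hQan : AnalyticAt ℂ (fun z => A z - F) k := hA.sub analyticAt_const
  have hQk : (A k - F).IsInvertible := by simpa [hFdef] using hQ
  have hQinv : ∀ᶠ z in 𝓝 k, (A z - F).IsInvertible :=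
    hQan.continuousAt.eventually (isOpen_isInvertible.mem_nhds hQk)
  -- with `F = J ∘ P` through the finite-dimensional range of `F`, the kernel of `A z` is carried by
  -- `P` onto the kernel of `D z = 1 + P (A z - F)⁻¹ J`
  let D : ℂ → E →L[ℂ] E := fun z => ContinuousLinearMap.id ℂ E + P ∘L (A z - F).inverse ∘L J
  have hDan : AnalyticAt ℂ D k :=
    analyticAt_const.add (((ContinuousLinearMap.compL ℂ E X E P).analyticAt _).comp
      ((((ContinuousLinearMap.compL ℂ E Y X).flip J).analyticAt _).comp
        (analyticAt_inverse_clm hQan hQk)))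
  let b := Module.finBasis ℂ E
  let d : ℂ → ℂ := fun z => LinearMap.det (D z).toLinearMap
  have hd : AnalyticAt ℂ d k := by
    have hentry : ∀ i j, AnalyticAt ℂ (fun z => b.repr (D z (b j)) i) k := fun i j =>
      ((LinearMap.toContinuousLinearMap (b.coord i)).analyticAt _).comp
        (((ContinuousLinearMap.apply ℂ E (b j)).analyticAt _).comp hDan)
    have : d = fun z => ∑ σ : Equiv.Perm (Fin (Module.finrank ℂ E)),
        ((Equiv.Perm.sign σ : ℤ) : ℂ) * ∏ i, b.repr (D z (b i)) (σ i) := by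
      funext z
      simp only [d, ← LinearMap.det_toMatrix b, Matrix.det_apply', LinearMap.toMatrix_apply]
      rfl
    rw [this]
    exact Finset.analyticAt_fun_sum _ fun σ _ => analyticAt_const.mul
      (Finset.analyticAt_fun_prod _ fun i _ => hentry _ _)
  have hdet : ∀ z, (A z - F).IsInvertible → (Function.Injective (A z) ↔ d z ≠ 0) := by
    intro z hz
    constructor
    · intro hinj h0
      obtain ⟨e, he, he0⟩ := Submodule.exists_mem_ne_zero_of_ne_bot
        (LinearMap.bot_lt_ker_of_det_eq_zero h0).ne'
      have he : e + P ((A z - F).inverse (J e)) = 0 := he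
      set x := (A z - F).inverse (J e) with hx
      have hx1 : A z x - F x = J e := hz.self_apply_inverse (J e)
      have hAx : A z x = 0 := by
        rw [sub_eq_iff_eq_add.1 hx1, ← hJP, ← map_add, he, map_zero]
      have hx0 : x = 0 := hinj (by simpa using hAx)
      rw [hx0, map_zero, add_zero] at he
      exact he0 he
    · intro h0
      refine (injective_iff_map_eq_zero _).2 fun x hx => ?_
      have h1 : (A z - F) x = - J (P x) := by simp [hx, hJP]
      have h2 : (A z - F).inverse (J (P x)) = - x := by
        rw [← neg_eq_iff_eq_neg, ← map_neg, ← h1, hz.inverse_apply_self]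
      have h3 : D z (P x) = 0 := by
        change P x + P ((A z - F).inverse (J (P x))) = 0
        rw [h2, map_neg, add_neg_cancel]
      have h4 : P x = 0 :=
        (LinearMap.equivOfDetNeZero (D z).toLinearMap h0).injective (h3.trans (map_zero _).symm)
      rw [h4, map_zero, neg_zero] at h1
      exact hz.injective (h1.trans (map_zero _).symm)
  rcases hd.eventually_eq_zero_or_eventually_ne_zero with h | h
  · left
    filter_upwards [h, hQinv] with z hz hzi hinj
    exact (hdet z hzi).1 hinj hz
  · right
    filter_upwards [h, hQinv.filter_mono nhdsWithin_le_nhds] with z hz hzi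
    refine IsInvertibleModFinite.isInvertible ⟨A z - F, hzi, ?_⟩ ((hdet z hzi).2 hz)
    rwa [sub_sub_cancel]

lemma IsHolomorphicFredholm.analyticAt [CompleteSpace Y] {Λ : Set ℂ} (hΛ : IsOpen Λ)
    {A : ℂ → X →L[ℂ] Y} (hA : IsHolomorphicFredholm Λ A) {k : ℂ} (hk : k ∈ Λ) :
    AnalyticAt ℂ A k :=
  DifferentiableOn.analyticAt (fun z hz => (hA.holomorphic z hz).differentiableWithinAt)
    (hΛ.mem_nhds hk)

/-- Eigenvalues are isolated: the set of points near which the function is nowhere invertible is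
open and closed in `Λ`, and is not all of `Λ`. -/
lemma IsHolomorphicFredholm.eventually_isInvertible [CompleteSpace X] [CompleteSpace Y]
    {Λ : Set ℂ} (hΛo : IsOpen Λ) (hΛc : IsConnected Λ) {A : ℂ → X →L[ℂ] Y}
    (hA : IsHolomorphicFredholm Λ A) {k : ℂ} (hk : k ∈ Λ) :
    ∀ᶠ z in 𝓝[≠] k, (A z).IsInvertible := by
  have hdich : ∀ z ∈ Λ, (∀ᶠ w in 𝓝 z, ¬ Function.Injective (A w)) ∨
      ∀ᶠ w in 𝓝[≠] z, (A w).IsInvertible := fun z hz =>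
    (hA.isInvertibleModFinite hΛc hz).eventually_not_injective_or_eventually_isInvertible
      (hA.analyticAt hΛo hz)
  set N : Set ℂ := {z | ∀ᶠ w in 𝓝 z, ¬ Function.Injective (A w)} with hN
  have hNo : IsOpen N := isOpen_iff_mem_nhds.2 fun z hz => eventually_eventually_nhds.2 hz
  refine (hdich k hk).resolve_left fun hbad => ?_
  have hsub : Λ ⊆ N := by
    refine hΛc.isPreconnected.subset_of_closure_inter_subset hNo ⟨k, hk, hbad⟩ ?_
    rintro z ⟨hcl, hz⟩
    refine (hdich z hz).resolve_right fun hgood => ?_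
    rw [eventually_nhdsWithin_iff] at hgood
    obtain ⟨w, hw, hwN⟩ := mem_closure_iff_nhds.1 hcl _ (eventually_eventually_nhds.2 hgood)
    have h1 : ∀ᶠ v in 𝓝 w, v = z := by
      filter_upwards [hw, hwN] with v hv hvN
      by_contra hne
      exact hvN (hv hne).injective
    have h2 : ∀ᶠ v in 𝓝[≠] w, v = z := h1.filter_mono nhdsWithin_le_nhds
    have h3 : ∀ᶠ v in 𝓝[≠] w, v ≠ w := eventually_mem_nhdsWithin
    obtain ⟨v, hv, hvw⟩ := (h2.and h3).exists
    exact hvw (hv.trans h1.self_of_nhds.symm)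
  obtain ⟨k₁, hk₁, hinv⟩ := hA.exists_invertible
  exact (hsub hk₁ : ∀ᶠ w in 𝓝 k₁, _).self_of_nhds hinv.injective

/-- Subtracting a rank one operator `f ⊗ y` from an invertible operator `M` destroys injectivity
exactly when `f (M⁻¹ y) = 1`. -/
lemma not_injective_iff_of_isInvertible_add_smulRight {T : X →L[ℂ] Y} {f : X →L[ℂ] ℂ} {y : Y}
    (hM : (T + f.smulRight y).IsInvertible) :
    ¬ Function.Injective T ↔ 1 - f ((T + f.smulRight y).inverse y) = 0 := by
  set M := T + f.smulRight y with hMdef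
  have hT : ∀ x, M x = T x + f x • y := fun x => by simp [hMdef]
  rw [sub_eq_zero]
  constructor
  · intro h
    rw [injective_iff_map_eq_zero] at h
    push Not at h
    obtain ⟨x, hx, hx0⟩ := h
    have h1 : x = f x • M.inverse y := by
      rw [← map_smul, ← zero_add (f x • y), ← hx, ← hT, hM.inverse_apply_self]
    have h2 : f x ≠ 0 := fun h0 => hx0 (by rw [h1, h0, zero_smul])
    have h3 := congrArg f h1
    rw [map_smul, smul_eq_mul] at h3
    exact mul_left_cancel₀ h2 (by simpa using h3)
  · intro h hinj
    have h1 : T (M.inverse y) = 0 := by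
      have := hT (M.inverse y)
      rw [hM.self_apply_inverse, ← h, one_smul] at this
      simpa using this.symm
    rw [hinj (h1.trans (map_zero T).symm), map_zero] at h
    exact one_ne_zero h

/-! ### Jordan chains and the order of the reduced function -/

lemma analyticAt_clm_apply {E : Type*} [NormedAddCommGroup E] [NormedSpace ℂ E]
    {A : E → X →L[ℂ] Y} {u : E → X} {e : E} (hA : AnalyticAt ℂ A e) (hu : AnalyticAt ℂ u e) :
    AnalyticAt ℂ (fun z => A z (u z)) e :=
  AnalyticAt.comp (g := fun q : (X →L[ℂ] Y) × X => q.1 q.2) (f := fun z => (A z, u z))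
    ((ContinuousLinearMap.id ℂ (X →L[ℂ] Y)).analyticAt_bilinear (A e, u e)) (hA.prod hu)

/-- The Leibniz rule for the application of an operator function to a vector function. -/
lemma iteratedDeriv_clm_apply [CompleteSpace X] [CompleteSpace Y] (n : ℕ)
    {A : ℂ → X →L[ℂ] Y} {u : ℂ → X} {k : ℂ}
    (hA : AnalyticAt ℂ A k) (hu : AnalyticAt ℂ u k) :
    iteratedDeriv n (fun z => A z (u z)) k =
      ∑ i ∈ Finset.range (n + 1),
        (n.choose i : ℂ) • iteratedDeriv i A k (iteratedDeriv (n - i) u k) := by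
  induction n generalizing A u with
  | zero => simp
  | succ n IH =>
    have hd : deriv (fun z => A z (u z)) =ᶠ[𝓝 k]
        (fun z => A z (deriv u z)) + fun z => deriv A z (u z) := by
      filter_upwards [hA.eventually_analyticAt, hu.eventually_analyticAt] with z hAz huz
      rw [deriv_clm_apply hAz.differentiableAt huz.differentiableAt, Pi.add_apply, add_comm]
    have h1 : AnalyticAt ℂ (fun z => A z (deriv u z)) k := analyticAt_clm_apply hA hu.deriv
    have h2 : AnalyticAt ℂ (fun z => deriv A z (u z)) k := analyticAt_clm_apply hA.deriv hu
    rw [iteratedDeriv_succ', hd.iteratedDeriv_eq, iteratedDeriv_add h1.contDiffAt h2.contDiffAt,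
      IH hA hu.deriv, IH hA.deriv hu, Finset.sum_range_succ' _ (n + 1),
      Finset.sum_range_succ' _ n]
    have e1 : ∀ i ∈ Finset.range n,
        (n.choose (i + 1) : ℂ) • iteratedDeriv (i + 1) A k
          (iteratedDeriv (n - (i + 1)) (deriv u) k) =
        (n.choose (i + 1) : ℂ) • iteratedDeriv (i + 1) A k (iteratedDeriv (n - i) u k) := by
      intro i hi
      have : n - i = n - (i + 1) + 1 := by have := Finset.mem_range.1 hi; omega
      rw [this, iteratedDeriv_succ' (f := u)]
    rw [Finset.sum_congr rfl e1]
    simp only [← iteratedDeriv_succ', Nat.choose_succ_succ', Nat.cast_add, add_smul,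
      Finset.sum_add_distrib, Nat.add_sub_add_right]
    rw [Finset.sum_range_succ (fun i => (n.choose (i + 1) : ℂ) • _) n]
    simp
    abel

lemma iteratedDeriv_sum_sub_pow_smul (n : ℕ) (φ : ℕ → X) (k : ℂ) {j : ℕ} (hj : j < n) :
    iteratedDeriv j (fun z => ∑ m ∈ Finset.range n, (z - k) ^ m • φ m) k =
      (j.factorial : ℂ) • φ j := by
  have hsm : ∀ m, iteratedDeriv j (fun z : ℂ => (z - k) ^ m • φ m) k =
      if m = j then (j.factorial : ℂ) • φ j else 0 := by
    intro m
    have h1 : iteratedDeriv j (fun z : ℂ => (z - k) ^ m) k =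
        if m = j then (j.factorial : ℂ) else 0 := by
      rw [iteratedDeriv_comp_sub_const j (fun z : ℂ => z ^ m) k]
      simp only [sub_self, iteratedDeriv_pow]
      rcases lt_trichotomy m j with h | h | h
      · simp [Nat.descFactorial_eq_zero_iff_lt.2 h, h.ne]
      · subst h
        simp [Nat.descFactorial_self]
      · rw [zero_pow (by omega), mul_zero, if_neg h.ne']
    rw [iteratedDeriv_smul_const (by fun_prop), h1]
    split_ifs with h
    · rw [h]
    · rw [zero_smul]
  rw [iteratedDeriv_fun_sum (fun m _ => by fun_prop)]
  simp_rw [hsm]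
  simp [hj]

/-- Jordan chains are the Taylor coefficients of root functions: vector functions `u` with
`u k ≠ 0` for which `A u` vanishes to high order at `k`. -/
lemma isJordanChain_iff_le_analyticOrderAt [CompleteSpace X] [CompleteSpace Y]
    {A : ℂ → X →L[ℂ] Y} {u : ℂ → X} {k : ℂ} (hA : AnalyticAt ℂ A k) (hu : AnalyticAt ℂ u k)
    {n : ℕ} {φ : ℕ → X} (hn : 1 ≤ n)
    (hφ : ∀ j < n, iteratedDeriv j u k = (j.factorial : ℂ) • φ j) :
    IsJordanChain A k n φ ↔ u k ≠ 0 ∧ n ≤ analyticOrderAt (fun z => A z (u z)) k := by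
  have h0 : u k = φ 0 := by simpa using hφ 0 hn
  rw [natCast_le_analyticOrderAt_iff_iteratedDeriv_eq_zero (analyticAt_clm_apply hA hu),
    IsJordanChain, h0, and_iff_right hn]
  refine and_congr_right fun _ => forall₂_congr fun j hj => ?_
  have : iteratedDeriv j (fun z => A z (u z)) k = (j.factorial : ℂ) •
      ∑ l ∈ Finset.range (j + 1), ((1 : ℂ) / (l.factorial : ℂ)) •
        (iteratedDeriv l A k) (φ (j - l)) := by
    rw [iteratedDeriv_clm_apply j hA hu, Finset.smul_sum]
    refine Finset.sum_congr rfl fun l hl => ?_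
    have hl : l ≤ j := by have := Finset.mem_range.1 hl; omega
    rw [hφ (j - l) (by omega), map_smul, smul_smul, smul_smul]
    congr 1
    rw [Nat.cast_choose ℂ hl]
    have h1 : (l.factorial : ℂ) ≠ 0 := by exact_mod_cast l.factorial_ne_zero
    have h2 : ((j - l).factorial : ℂ) ≠ 0 := by exact_mod_cast (j - l).factorial_ne_zero
    field_simp
  rw [this, smul_eq_zero_iff_right (by exact_mod_cast j.factorial_ne_zero)]

section Bordered

variable [CompleteSpace X] [CompleteSpace Y] {A : ℂ → X →L[ℂ] Y} {k : ℂ}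
  {f : X →L[ℂ] ℂ} {y : Y}

/-- The length of a Jordan chain is at most the order of vanishing of the scalar function
`1 - f (M⁻¹ y)`, where `M = A + f ⊗ y`. -/
lemma IsJordanChain.le_analyticOrderAt (hA : AnalyticAt ℂ A k)
    (hM : (A k + f.smulRight y).IsInvertible) {n : ℕ} {φ : ℕ → X} (h : IsJordanChain A k n φ) :
    n ≤ analyticOrderAt (fun z => 1 - f ((A z + f.smulRight y).inverse y)) k := by
  set u : ℂ → X := fun z => ∑ m ∈ Finset.range n, (z - k) ^ m • φ m
  have hu : AnalyticAt ℂ u k := Finset.analyticAt_fun_sum _ fun m _ =>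
    ((analyticAt_id.sub analyticAt_const).pow m).smul analyticAt_const
  obtain ⟨hu0, hord⟩ := (isJordanChain_iff_le_analyticOrderAt hA hu h.1
    fun j hj => iteratedDeriv_sum_sub_pow_smul n φ k hj).1 h
  have hMan : AnalyticAt ℂ (fun z => A z + f.smulRight y) k := hA.add analyticAt_const
  have hinvan := analyticAt_inverse_clm hMan hM
  have hg : AnalyticAt ℂ (fun z => 1 - f ((A z + f.smulRight y).inverse y)) k :=
    analyticAt_const.sub ((f.analyticAt _).comp (analyticAt_clm_apply hinvan analyticAt_const))
  have hfu : AnalyticAt ℂ (fun z => f (u z)) k := (f.analyticAt _).comp hu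
  -- on the kernel of `A k` the functional `f` is injective
  have hfu0 : f (u k) ≠ 0 := by
    intro h0
    have hAu : A k (u k) = 0 := by
      refine apply_eq_zero_of_analyticOrderAt_ne_zero (f := fun z => A z (u z)) fun hz => ?_
      have h1 := h.1
      rw [hz] at hord
      have : n ≤ 0 := by exact_mod_cast hord
      omega
    exact hu0 (hM.injective (by simp [hAu, h0]))
  obtain ⟨G, hG, hFG⟩ := (natCast_le_analyticOrderAt (analyticAt_clm_apply hA hu)).1 hord
  have hprod : (n : ℕ∞) ≤ analyticOrderAt
      ((fun z => f (u z)) * fun z => 1 - f ((A z + f.smulRight y).inverse y)) k := by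
    refine (natCast_le_analyticOrderAt (hfu.mul hg)).2
      ⟨fun z => f ((A z + f.smulRight y).inverse (G z)),
        (f.analyticAt _).comp (analyticAt_clm_apply hinvan hG), ?_⟩
    filter_upwards [hFG, hMan.continuousAt.eventually (isOpen_isInvertible.mem_nhds hM)]
      with z hz hMz
    have h1 : (A z + f.smulRight y) (u z) = (z - k) ^ n • G z + f (u z) • y := by
      rw [← hz]; simp
    have h2 := congrArg (fun v => f ((A z + f.smulRight y).inverse v)) h1
    simp only [hMz.inverse_apply_self, map_add, map_smul, smul_eq_mul] at h2
    simp only [Pi.mul_apply, smul_eq_mul]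
    linear_combination h2
  rwa [analyticOrderAt_mul hfu hg, hfu.analyticOrderAt_eq_zero.2 hfu0, zero_add] at hprod

/-- The function `z ↦ (A z + f ⊗ y)⁻¹ y` is a root function of maximal order. -/
lemma exists_isJordanChain (hA : AnalyticAt ℂ A k)
    (hM : (A k + f.smulRight y).IsInvertible) {n : ℕ} (hn : 1 ≤ n)
    (h : n ≤ analyticOrderAt (fun z => 1 - f ((A z + f.smulRight y).inverse y)) k) :
    ∃ φ, IsJordanChain A k n φ := by
  set u : ℂ → X := fun z => (A z + f.smulRight y).inverse y
  have hMan : AnalyticAt ℂ (fun z => A z + f.smulRight y) k := hA.add analyticAt_const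
  have hu : AnalyticAt ℂ u k :=
    analyticAt_clm_apply (analyticAt_inverse_clm hMan hM) analyticAt_const
  have hg : AnalyticAt ℂ (fun z => 1 - f (u z)) k :=
    analyticAt_const.sub ((f.analyticAt _).comp hu)
  refine ⟨fun j => (j.factorial : ℂ)⁻¹ • iteratedDeriv j u k,
    (isJordanChain_iff_le_analyticOrderAt hA hu hn fun j _ => ?_).2 ⟨fun h0 => ?_, ?_⟩⟩
  · rw [smul_inv_smul₀ (by exact_mod_cast j.factorial_ne_zero)]
  · have h1 : 1 - f (u k) = 0 :=
      apply_eq_zero_of_analyticOrderAt_ne_zero (f := fun z => 1 - f (u z)) fun hz => by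
        rw [hz] at h
        have : n ≤ 0 := by exact_mod_cast h
        omega
    simp [h0] at h1
  · obtain ⟨G, hG, hgG⟩ := (natCast_le_analyticOrderAt hg).1 h
    refine (natCast_le_analyticOrderAt (analyticAt_clm_apply hA hu)).2
      ⟨fun z => G z • y, hG.smul analyticAt_const, ?_⟩
    filter_upwards [hgG, hMan.continuousAt.eventually (isOpen_isInvertible.mem_nhds hM)]
      with z hz hMz
    have h1 : A z (u z) + f (u z) • y = y := hMz.self_apply_inverse y
    rw [← smul_assoc, ← hz, sub_smul, one_smul, ← sub_eq_iff_eq_add.2 h1.symm]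

/-- At an eigenvalue of geometric multiplicity one, the algebraic multiplicity is the order of
vanishing of `1 - f (M⁻¹ y)`, where `M = A + f ⊗ y`. -/
lemma algebraicMultiplicity_eq_of_analyticOrderAt_eq (hA : AnalyticAt ℂ A k)
    (hM : (A k + f.smulRight y).IsInvertible) (hgeo : geometricMultiplicity A k = 1)
    {p : ℕ} (hp : 1 ≤ p)
    (hord : analyticOrderAt (fun z => 1 - f ((A z + f.smulRight y).inverse y)) k = p) :
    algebraicMultiplicity A k = p := by
  have hbound : ∀ {n : ℕ} {φ : ℕ → X}, IsJordanChain A k n φ → n ≤ p := fun {n φ} h => by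
    have := h.le_analyticOrderAt hA hM
    rw [hord] at this
    exact_mod_cast this
  obtain ⟨φ, hφ⟩ := exists_isJordanChain hA hM hp hord.ge
  have hφker : φ 0 ∈ LinearMap.ker (A k).toLinearMap := by
    have := hφ.2.2 0 hp
    simpa using this
  have hset : {q : ℕ | ∃ (m : ℕ) (n : Fin m → ℕ) (φ : Fin m → ℕ → X),
      IsCanonicalSystem A k m n φ ∧ q = ∑ i, n i} = {p} := by
    ext q
    simp only [mem_ofPred_eq, mem_singleton_iff]
    constructor
    · rintro ⟨m, n, ψ, hψ, rfl⟩
      have hm : m = 1 := by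
        have := finrank_span_eq_card hψ.linearIndependent
        rw [hψ.span_eq] at this
        rw [geometricMultiplicity] at hgeo
        simpa using this.symm.trans hgeo
      subst hm
      rw [Fin.sum_univ_one]
      refine le_antisymm (hbound (hψ.chain 0)) (hψ.maximal 0 p φ hφ ?_)
      simpa using hφ.2.1
    · rintro rfl
      have hli : LinearIndependent ℂ (fun _ : Fin 1 => φ 0) :=
        LinearIndependent.of_subsingleton 0 hφ.2.1
      refine ⟨1, fun _ => q, fun _ => φ, ⟨fun _ => hφ, ?_, ?_, fun _ N ψ hψ _ => hbound hψ⟩,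
        by simp⟩
      · exact hli
      · have hle : Submodule.span ℂ (Set.range fun _ : Fin 1 => φ 0) ≤
            LinearMap.ker (A k).toLinearMap := by
          rw [Submodule.span_le]
          rintro _ ⟨_, rfl⟩
          exact hφker
        have : FiniteDimensional ℂ (LinearMap.ker (A k).toLinearMap) :=
          Module.finite_of_finrank_eq_succ hgeo
        refine Submodule.eq_of_le_of_finrank_eq hle ?_
        rw [finrank_span_eq_card hli]
        exact hgeo.symm
  rw [algebraicMultiplicity, hset, csInf_singleton]

end Bordered

end Operators

/-! ### Zeros of holomorphic functions: factorization, power sums, parameters -/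

/-- Splitting off the zero at a point with full multiplicity, keeping the domain of holomorphy. -/
lemma exists_eq_pow_mul_of_analyticOrderAt_ne_top {h : ℂ → ℂ} {U : Set ℂ}
    (hh : AnalyticOnNhd ℂ h U) {a : ℂ} (ha : a ∈ U) (hord : analyticOrderAt h a ≠ ⊤) :
    ∃ (n : ℕ) (u : ℂ → ℂ), AnalyticOnNhd ℂ u U ∧ u a ≠ 0 ∧ ∀ z, h z = (z - a) ^ n * u z := by
  obtain ⟨v, hv, hva, hev⟩ := (hh a ha).analyticOrderAt_ne_top.1 hord
  set n := analyticOrderNatAt h a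
  have hself := hev.self_of_nhds
  classical
  -- the quotient, with its removable singularity at `a` filled in
  set u : ℂ → ℂ := Function.update (fun z => h z / (z - a) ^ n) a (v a) with hu
  have hne : ∀ z, z ≠ a → u z = h z / (z - a) ^ n := fun z hz => Function.update_of_ne hz _ _
  have hua : u a = v a := Function.update_self _ _ _
  refine ⟨n, u, fun z hz => ?_, by rwa [hua], fun z => ?_⟩
  · rcases eq_or_ne z a with rfl | hza
    · refine hv.congr ?_
      filter_upwards [hev] with w hw
      rcases eq_or_ne w z with rfl | hwz
      · exact hua.symm
      · rw [hne w hwz, hw, smul_eq_mul, mul_div_cancel_left₀ _ (pow_ne_zero _ (sub_ne_zero.2 hwz))]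
    · have h1 : AnalyticAt ℂ (fun z => h z / (z - a) ^ n) z :=
        (hh z hz).div ((analyticAt_id.sub analyticAt_const).pow n)
          (pow_ne_zero _ (sub_ne_zero.2 hza))
      refine h1.congr ?_
      filter_upwards [isOpen_ne.mem_nhds hza] with w hw
      exact (hne w hw).symm
  · rcases eq_or_ne z a with rfl | hza
    · rw [hua]
      exact hself
    · rw [hne z hza, mul_div_cancel₀ _ (pow_ne_zero _ (sub_ne_zero.2 hza))]

/-- A holomorphic function with only finite order zeros on a compact set is there a product of
linear factors and a zero-free holomorphic function. -/
lemma exists_multiset_prod_mul {U K : Set ℂ} (hK : IsCompact K) (hKU : K ⊆ U)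
    {h : ℂ → ℂ} (hh : AnalyticOnNhd ℂ h U) (hord : ∀ z ∈ K, analyticOrderAt h z ≠ ⊤) :
    ∃ (s : Multiset ℂ) (u : ℂ → ℂ), (∀ a ∈ s, a ∈ K) ∧ AnalyticOnNhd ℂ u U ∧ (∀ z ∈ K, u z ≠ 0) ∧
      ∀ z, h z = (s.map fun a => z - a).prod * u z := by
  have hfin : (K ∩ {z | h z = 0}).Finite := by
    have hnear : ∀ z ∈ K, {w | h w = 0 → w = z} ∈ 𝓝 z := by
      intro z hz
      have := (hh z (hKU hz)).eventually_eq_zero_or_eventually_ne_zero.resolve_left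
        fun h0 => hord z hz (analyticOrderAt_eq_top.2 h0)
      rw [eventually_nhdsWithin_iff] at this
      filter_upwards [this] with w hw h0
      by_contra hne
      exact hw hne h0
    obtain ⟨t, -, ht⟩ := hK.elim_nhds_subcover _ hnear
    refine t.finite_toSet.subset ?_
    rintro z ⟨hz, hz0⟩
    obtain ⟨a, ha, haz⟩ := mem_iUnion₂.1 (ht hz)
    rw [haz hz0]
    exact ha
  obtain ⟨S, hS⟩ := hfin.exists_finset_coe
  induction S using Finset.induction_on generalizing h with
  | empty =>
    refine ⟨0, h, by simp, hh, fun z hz h0 => ?_, by simp⟩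
    have : z ∈ K ∩ {z | h z = 0} := ⟨hz, h0⟩
    simp [← hS] at this
  | insert a S haS IH =>
    have haK : a ∈ K ∩ {z | h z = 0} := by simp [← hS]
    obtain ⟨n, u, hu, hua, heq⟩ :=
      exists_eq_pow_mul_of_analyticOrderAt_ne_top hh (hKU haK.1) (hord a haK.1)
    have hzero : (S : Set ℂ) = K ∩ {z | u z = 0} := by
      ext z
      have hz : (z = a ∨ z ∈ S) ↔ z ∈ K ∧ h z = 0 := by
        simpa using (Set.ext_iff.1 hS z)
      simp only [Finset.mem_coe, mem_inter_iff, mem_ofPred_eq]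
      rcases eq_or_ne z a with rfl | hza
      · simp [haS, hua]
      · rw [← or_iff_right (b := z ∈ S) hza, hz, heq z, mul_eq_zero,
          or_iff_right (pow_ne_zero _ (sub_ne_zero.2 hza))]
    have hord' : ∀ z ∈ K, analyticOrderAt u z ≠ ⊤ := by
      intro z hz h0
      refine hord z hz (analyticOrderAt_eq_top.2 ?_)
      filter_upwards [analyticOrderAt_eq_top.1 h0] with w hw
      rw [heq w, hw, mul_zero]
    obtain ⟨s, v, hs, hv, hv0, hprod⟩ := IH hu hord' (hzero ▸ S.finite_toSet) hzero
    refine ⟨Multiset.replicate n a + s, v, fun b hb => ?_, hv, hv0, fun z => ?_⟩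
    · rcases Multiset.mem_add.1 hb with hb | hb
      · rw [Multiset.eq_of_mem_replicate hb]
        exact haK.1
      · exact hs b hb
    · rw [heq z, hprod z, Multiset.map_add, Multiset.prod_add, Multiset.map_replicate,
        Multiset.prod_replicate, mul_assoc]

lemma differentiable_multiset_prod_sub (s : Multiset ℂ) :
    Differentiable ℂ fun z => (s.map fun a => z - a).prod := by
  induction s using Multiset.induction_on with
  | empty => simp
  | cons a s IH =>
    simp only [Multiset.map_cons, Multiset.prod_cons]
    exact (differentiable_id.sub_const a).mul IH

/-- The generalized argument principle: weighted contour integrals of the logarithmic derivative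
are the power sums of the zeros. -/
lemma circleIntegral_pow_mul_logDeriv {U : Set ℂ} {c : ℂ} {r : ℝ} (hr : 0 < r)
    (hU : closedBall c r ⊆ U) {u : ℂ → ℂ} (hu : AnalyticOnNhd ℂ u U)
    (hu0 : ∀ z ∈ closedBall c r, u z ≠ 0) (m : ℕ) (s : Multiset ℂ) (hs : ∀ a ∈ s, a ∈ ball c r) :
    (∮ z in C(c, r), (z - c) ^ m * logDeriv (fun z => (s.map fun a => z - a).prod * u z) z) =
      2 * Real.pi * Complex.I * (s.map fun a => (a - c) ^ m).sum := by
  have hpow : Differentiable ℂ fun z : ℂ => (z - c) ^ m := by fun_prop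
  induction s using Multiset.induction_on with
  | empty =>
    simp only [Multiset.map_zero, Multiset.prod_zero, one_mul, Multiset.sum_zero, mul_zero]
    have hd : ∀ z ∈ closedBall c r,
        DifferentiableAt ℂ (fun z => (z - c) ^ m * logDeriv u z) z := fun z hz =>
      (hpow z).mul (((hu z (hU hz)).deriv.differentiableAt).div (hu z (hU hz)).differentiableAt
        (hu0 z hz))
    exact Complex.circleIntegral_eq_zero_of_differentiable_on_off_countable hr.le countable_empty
      (fun z hz => (hd z hz).continuousAt.continuousWithinAt)
      (fun z hz => hd z (ball_subset_closedBall hz.1))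
  | cons b s IH =>
    have IH := IH fun a ha => hs a (Multiset.mem_cons_of_mem ha)
    have hb := hs b (Multiset.mem_cons_self b s)
    set w : ℂ → ℂ := fun z => (s.map fun a => z - a).prod * u z with hw
    have hwan : ∀ z ∈ sphere c r, AnalyticAt ℂ w z := fun z hz =>
      ((differentiable_multiset_prod_sub s).analyticAt z).mul
        (hu z (hU (sphere_subset_closedBall hz)))
    have hne : ∀ z ∈ sphere c r, ∀ a ∈ ball c r, z - a ≠ 0 := by
      intro z hz a ha h0
      rw [sub_eq_zero.1 h0, mem_sphere] at hz
      exact (mem_ball.1 ha).ne hz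
    have hw0 : ∀ z ∈ sphere c r, w z ≠ 0 := by
      intro z hz
      refine mul_ne_zero (Multiset.prod_ne_zero fun h0 => ?_) (hu0 z (sphere_subset_closedBall hz))
      obtain ⟨a, ha, ha0⟩ := Multiset.mem_map.1 h0
      exact hne z hz a (hs a (Multiset.mem_cons_of_mem ha)) ha0
    have hcongr : EqOn (fun z => (z - c) ^ m *
        logDeriv (fun z => ((b ::ₘ s).map fun a => z - a).prod * u z) z)
        (fun z => (z - b)⁻¹ • (z - c) ^ m + (z - c) ^ m * logDeriv w z) (sphere c r) := by
      intro z hz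
      have h1 : (fun z => ((b ::ₘ s).map fun a => z - a).prod * u z) = fun z => (z - b) * w z := by
        funext z
        simp [hw, mul_assoc]
      simp only
      rw [h1, logDeriv_mul z (hne z hz b hb) (hw0 z hz) (by fun_prop) (hwan z hz).differentiableAt]
      simp [logDeriv_apply]
      ring
    have hi1 : CircleIntegrable (fun z => (z - b)⁻¹ • (z - c) ^ m) c r :=
      ContinuousOn.circleIntegrable hr.le fun z hz =>
        (((continuousAt_id.sub continuousAt_const).inv₀ (hne z hz b hb)).smul
          (hpow z).continuousAt).continuousWithinAt
    have hi2 : CircleIntegrable (fun z => (z - c) ^ m * logDeriv w z) c r :=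
      ContinuousOn.circleIntegrable hr.le fun z hz =>
        ((hpow z).continuousAt.mul ((hwan z hz).deriv.continuousAt.div (hwan z hz).continuousAt
          (hw0 z hz))).continuousWithinAt
    rw [circleIntegral.integral_congr hr.le hcongr, circleIntegral.integral_add hi1 hi2, IH,
      DifferentiableOn.circleIntegral_sub_inv_smul hpow.differentiableOn hb]
    simp [mul_add]

/-- Holomorphic dependence of a contour integral on a parameter. -/
lemma differentiableOn_circleIntegral {V : Set ℂ} (hV : IsOpen V) {c : ℂ} {r : ℝ} (hr : 0 ≤ r)
    {Ψ : ℂ × ℂ → ℂ} (hΨ : ∀ ε ∈ V, ∀ z ∈ sphere c r, AnalyticAt ℂ Ψ (ε, z)) :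
    DifferentiableOn ℂ (fun ε => ∮ z in C(c, r), Ψ (ε, z)) V := by
  intro ε₀ hε₀
  obtain ⟨ρ, hρ, hρV⟩ := nhds_basis_closedBall.mem_iff.1 (hV.mem_nhds hε₀)
  set Ψ' : ℂ × ℂ → ℂ := fun q => fderiv ℂ Ψ q (1, 0) with hΨ'
  have hΨ'c : ∀ ε ∈ V, ∀ z ∈ sphere c r, ContinuousAt Ψ' (ε, z) := fun ε hε z hz =>
    (hΨ ε hε z hz).fderiv.continuousAt.clm_apply continuousAt_const
  have hK : IsCompact (closedBall ε₀ ρ ×ˢ sphere c r) :=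
    (isCompact_closedBall _ _).prod (isCompact_sphere _ _)
  obtain ⟨C, hC⟩ := hK.exists_bound_of_continuousOn (f := Ψ') fun q hq =>
    (hΨ'c q.1 (hρV hq.1) q.2 hq.2).continuousWithinAt
  have hmem : ∀ θ, circleMap c r θ ∈ sphere c r := fun θ => circleMap_mem_sphere c hr θ
  have hslice : ∀ {Φ : ℂ × ℂ → ℂ} {ε : ℂ}, (∀ z ∈ sphere c r, ContinuousAt Φ (ε, z)) →
      Continuous fun θ : ℝ => deriv (circleMap c r) θ • Φ (ε, circleMap c r θ) := by
    intro Φ ε hΦ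
    have h1 : Continuous fun θ : ℝ => deriv (circleMap c r) θ := by
      simp only [deriv_circleMap]
      fun_prop
    refine h1.smul (continuous_iff_continuousAt.2 fun θ => ?_)
    exact ContinuousAt.comp (f := fun θ : ℝ => (ε, circleMap c r θ)) (hΦ _ (hmem θ))
      (by fun_prop)
  have hmain := (intervalIntegral.hasDerivAt_integral_of_dominated_loc_of_deriv_le
    (μ := MeasureTheory.volume) (a := 0) (b := 2 * Real.pi)
    (F := fun ε θ => deriv (circleMap c r) θ • Ψ (ε, circleMap c r θ))
    (F' := fun ε θ => deriv (circleMap c r) θ • Ψ' (ε, circleMap c r θ))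
    (x₀ := ε₀) (s := closedBall ε₀ ρ) (bound := fun _ => r * C)
    (closedBall_mem_nhds _ hρ) ?_ ?_ ?_ ?_ ?_ ?_).2
  · exact hmain.differentiableAt.differentiableWithinAt
  · filter_upwards [hV.mem_nhds hε₀] with ε hε
    exact (hslice fun z hz => (hΨ ε hε z hz).continuousAt).aestronglyMeasurable
  · exact (hslice fun z hz => (hΨ ε₀ hε₀ z hz).continuousAt).intervalIntegrable _ _
  · exact (hslice fun z hz => hΨ'c ε₀ hε₀ z hz).aestronglyMeasurable
  · refine Eventually.of_forall fun θ _ ε hε => ?_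
    rw [norm_smul]
    have h1 : ‖deriv (circleMap c r) θ‖ = r := by simp [deriv_circleMap, abs_of_nonneg hr]
    rw [h1]
    exact mul_le_mul_of_nonneg_left (hC (ε, circleMap c r θ) ⟨hε, hmem θ⟩) hr
  · exact intervalIntegrable_const
  · refine Eventually.of_forall fun θ _ ε hε => ?_
    have h1 : HasDerivAt (fun ε : ℂ => (ε, circleMap c r θ)) ((1 : ℂ), (0 : ℂ)) ε :=
      (hasDerivAt_id ε).prodMk (hasDerivAt_const ε _)
    have h2 : HasDerivAt (fun ε : ℂ => Ψ (ε, circleMap c r θ)) (Ψ' (ε, circleMap c r θ)) ε :=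
      (hΨ ε (hρV hε) _ (hmem θ)).differentiableAt.hasFDerivAt.comp_hasDerivAt ε h1
    exact h2.const_mul (deriv (circleMap c r) θ)

/-- Newton's identities for multisets. -/
lemma mul_multiset_esymm_eq_sum (s : Multiset ℂ) (k : ℕ) :
    k * s.esymm k = (-1) ^ (k + 1) *
      ∑ a ∈ Finset.HasAntidiagonal.antidiagonal k with a.1 < k,
        (-1) ^ a.1 * s.esymm a.1 * (s.map (· ^ a.2)).sum := by
  have hs : (Finset.univ : Finset (Fin s.toList.length)).val.map s.toList.get = s := by
    conv_rhs => rw [← Multiset.coe_toList s]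
    rw [Fin.univ_val_map, List.ofFn_get]
  have := congrArg (MvPolynomial.aeval s.toList.get)
    (MvPolynomial.mul_esymm_eq_sum (Fin s.toList.length) ℂ k)
  simp only [map_mul, map_natCast, map_pow, map_neg, map_one, map_sum,
    MvPolynomial.aeval_esymm_eq_multiset_esymm, hs] at this
  rw [this]
  congr 1
  refine Finset.sum_congr rfl fun a _ => ?_
  congr 1
  rw [MvPolynomial.psum, map_sum]
  simp only [map_pow, MvPolynomial.aeval_X]
  conv_rhs => rw [← hs, Multiset.map_map]
  rfl

/-- If the power sums of a varying multiset are holomorphic, so are its elementary symmetric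
functions. -/
lemma differentiableOn_multiset_esymm {V : Set ℂ} {S : ℂ → Multiset ℂ}
    (hS : ∀ m, DifferentiableOn ℂ (fun ε => ((S ε).map (· ^ m)).sum) V) (k : ℕ) :
    DifferentiableOn ℂ (fun ε => (S ε).esymm k) V := by
  induction k using Nat.strong_induction_on with
  | _ k IH =>
    rcases Nat.eq_zero_or_pos k with rfl | hk
    · simp [Multiset.esymm]
    · have hk0 : (k : ℂ) ≠ 0 := by exact_mod_cast hk.ne'
      have heq : (fun ε => (S ε).esymm k) = fun ε => (k : ℂ)⁻¹ * ((-1) ^ (k + 1) *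
          ∑ a ∈ Finset.HasAntidiagonal.antidiagonal k with a.1 < k,
            (-1) ^ a.1 * (S ε).esymm a.1 * ((S ε).map (· ^ a.2)).sum) := by
        funext ε
        rw [← mul_multiset_esymm_eq_sum, inv_mul_cancel_left₀ hk0]
      rw [heq]
      refine DifferentiableOn.const_mul (DifferentiableOn.const_mul
        (DifferentiableOn.fun_sum fun a ha => ?_) _) _
      exact ((IH a.1 (Finset.mem_filter.1 ha).2).const_mul _).mul (hS a.2)

/-! ### Weierstrass preparation -/

/-- Vieta's formulas, for a polynomial written in powers of `X - k₀`. -/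
lemma weierstrassPolynomial_esymm_eq_prod (k₀ : ℂ) {p : ℕ} {s : Multiset ℂ}
    (hs : Multiset.card s = p) :
    weierstrassPolynomial k₀ p
        (fun j => (-1) ^ (p - (j : ℕ)) * (s.map fun a => a - k₀).esymm (p - j)) =
      (s.map fun a => Polynomial.X - Polynomial.C a).prod := by
  set t := s.map fun a => a - k₀ with ht
  have htc : Multiset.card t = p := by rw [ht, Multiset.card_map, hs]
  have h1 := congrArg (fun P : Polynomial ℂ => P.comp (Polynomial.X - Polynomial.C k₀))
    (Multiset.prod_X_sub_X_eq_sum_esymm t)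
  simp only [Polynomial.multiset_prod_comp, Multiset.map_map, ht, Function.comp_def,
    Polynomial.sub_comp, Polynomial.X_comp, Polynomial.C_comp, Polynomial.sum_comp,
    Polynomial.mul_comp, Polynomial.pow_comp, Polynomial.neg_comp, Polynomial.one_comp] at h1
  simp only [← ht, htc] at h1
  have h2 : (s.map fun a => Polynomial.X - Polynomial.C a).prod =
      (s.map fun a => Polynomial.X - Polynomial.C k₀ - Polynomial.C (a - k₀)).prod := by
    congr 1
    refine Multiset.map_congr rfl fun a _ => ?_
    rw [Polynomial.C_sub]
    ring
  rw [h2, h1, weierstrassPolynomial, ← Finset.sum_range_reflect, Finset.sum_range_succ, add_comm,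
    Finset.sum_range]
  congr 1
  · refine Finset.sum_congr rfl fun j _ => ?_
    have e1 : p + 1 - 1 - (j : ℕ) = p - j := by omega
    have e2 : p - (p - (j : ℕ)) = j := by omega
    rw [e1, e2]
    simp [mul_assoc]
  · simp [Multiset.esymm]

/-- **Weierstrass preparation** for a function of two variables, at the level of zero sets: if
`G (0, ·)` has a zero of order `p` at `k₀`, then near `(0, k₀)` the zeros of `G (ε, ·)` are those
of a polynomial of degree `p` with coefficients holomorphic in `ε`. -/
theorem exists_weierstrassPolynomial {G : ℂ × ℂ → ℂ} {k₀ : ℂ} {p : ℕ}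
    (hG : AnalyticAt ℂ G (0, k₀)) (hord : analyticOrderAt (fun k => G (0, k)) k₀ = p)
    {Ω : Set (ℂ × ℂ)} (hΩ : Ω ∈ 𝓝 ((0, k₀) : ℂ × ℂ)) :
    ∃ (V Λ₀ : Set ℂ) (c : Fin p → ℂ → ℂ),
      IsOpen V ∧ (0 : ℂ) ∈ V ∧ IsOpen Λ₀ ∧ k₀ ∈ Λ₀ ∧ V ×ˢ Λ₀ ⊆ Ω ∧
      (∀ j, DifferentiableOn ℂ (c j) V) ∧
      (∀ j, c j 0 = 0) ∧
      (∀ ε ∈ V, zerosIn (weierstrassPolynomial k₀ p (fun j => c j ε)) Λ₀ = p) ∧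
      (∀ ε ∈ V, ∀ k ∈ Λ₀,
        G (ε, k) = 0 ↔ (weierstrassPolynomial k₀ p (fun j => c j ε)).IsRoot k) := by
  -- a bidisc on which `G` is holomorphic and `G (0, ·)` vanishes at most at `k₀`
  obtain ⟨δ₁, hδ₁, R₁, hR₁, hball⟩ : ∃ δ > 0, ∃ R > 0,
      ball (0 : ℂ) δ ×ˢ ball k₀ R ⊆ Ω ∩ {q | AnalyticAt ℂ G q} := by
    obtain ⟨U₁, hU₁, U₂, hU₂, hsub⟩ :=
      mem_nhds_prod_iff.1 (inter_mem hΩ hG.eventually_analyticAt)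
    obtain ⟨δ, hδ, h1⟩ := Metric.mem_nhds_iff.1 hU₁
    obtain ⟨R, hR, h2⟩ := Metric.mem_nhds_iff.1 hU₂
    exact ⟨δ, hδ, R, hR, (prod_mono h1 h2).trans hsub⟩
  have hGan : ∀ ε ∈ ball (0 : ℂ) δ₁, ∀ z ∈ ball k₀ R₁, AnalyticAt ℂ G (ε, z) :=
    fun ε hε z hz => (hball (mk_mem_prod hε hz)).2
  have hslice : ∀ ε ∈ ball (0 : ℂ) δ₁, AnalyticOnNhd ℂ (fun z => G (ε, z)) (ball k₀ R₁) :=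
    fun ε hε z hz => AnalyticAt.comp (g := G) (f := fun z => (ε, z)) (hGan ε hε z hz)
      (analyticAt_const.prod analyticAt_id)
  have h0δ : (0 : ℂ) ∈ ball (0 : ℂ) δ₁ := mem_ball_self hδ₁
  have hk₀R : k₀ ∈ ball k₀ R₁ := mem_ball_self hR₁
  have hord_ne : analyticOrderAt (fun k => G (0, k)) k₀ ≠ ⊤ := by simp [hord]
  obtain ⟨R₂, hR₂, hiso⟩ : ∃ R > 0, ∀ z ∈ ball k₀ R, z ≠ k₀ → G (0, z) ≠ 0 := by
    have := (hslice 0 h0δ k₀ hk₀R).eventually_eq_zero_or_eventually_ne_zero.resolve_left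
      fun h0 => hord_ne (analyticOrderAt_eq_top.2 h0)
    rw [eventually_nhdsWithin_iff] at this
    obtain ⟨R, hR, h⟩ := Metric.mem_nhds_iff.1 this
    exact ⟨R, hR, fun z hz hne => h hz hne⟩
  set r := min R₁ R₂ / 2
  have hmin : 0 < min R₁ R₂ := lt_min hR₁ hR₂
  have hr : 0 < r := by positivity
  have hrR₁ : r < R₁ := (half_lt_self hmin).trans_le (min_le_left _ _)
  have hrR₂ : r < R₂ := (half_lt_self hmin).trans_le (min_le_right _ _)
  have hcb₁ : closedBall k₀ r ⊆ ball k₀ R₁ := closedBall_subset_ball hrR₁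
  have hcb₂ : closedBall k₀ r ⊆ ball k₀ R₂ := closedBall_subset_ball hrR₂
  -- a smaller disc of parameters for which `G (ε, ·)` has no zeros on the circle
  obtain ⟨δ₂, hδ₂, hδ₂₁, hsphere⟩ : ∃ δ > 0, δ ≤ δ₁ ∧ ∀ ε ∈ ball (0 : ℂ) δ,
      ∀ z ∈ sphere k₀ r, G (ε, z) ≠ 0 := by
    have hev : ∀ᶠ ε in 𝓝 (0 : ℂ), ∀ z ∈ sphere k₀ r, G (ε, z) ≠ 0 := by
      refine (isCompact_sphere k₀ r).eventually_forall_of_forall_eventually fun z hz => ?_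
      refine (hGan 0 h0δ z (hcb₁ (sphere_subset_closedBall hz))).continuousAt.eventually_ne ?_
      exact hiso z (hcb₂ (sphere_subset_closedBall hz)) (ne_of_mem_sphere hz hr.ne')
    obtain ⟨δ, hδ, h⟩ := Metric.mem_nhds_iff.1 hev
    exact ⟨min δ δ₁, lt_min hδ hδ₁, min_le_right _ _,
      fun ε hε => h (ball_subset_ball (min_le_left _ _) hε)⟩
  have hsub : ball (0 : ℂ) δ₂ ⊆ ball 0 δ₁ := ball_subset_ball hδ₂₁
  -- the zeros in the disc, with multiplicity
  have hfactor : ∀ ε ∈ ball (0 : ℂ) δ₂, ∃ (s : Multiset ℂ) (u : ℂ → ℂ),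
      (∀ a ∈ s, a ∈ ball k₀ r) ∧ AnalyticOnNhd ℂ u (ball k₀ R₁) ∧
      (∀ z ∈ closedBall k₀ r, u z ≠ 0) ∧
      ∀ z, G (ε, z) = (s.map fun a => z - a).prod * u z := by
    intro ε hε
    obtain ⟨w, hw⟩ : (sphere k₀ r).Nonempty := NormedSpace.sphere_nonempty.2 hr.le
    have hordw : analyticOrderAt (fun z => G (ε, z)) w ≠ ⊤ := by
      rw [(hslice ε (hsub hε) w (hcb₁ (sphere_subset_closedBall hw))).analyticOrderAt_eq_zero.2
        (hsphere ε hε w hw)]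
      simp
    obtain ⟨s, u, hs, hu, hu0, hprod⟩ := exists_multiset_prod_mul (isCompact_closedBall k₀ r) hcb₁
      (hslice ε (hsub hε)) fun z hz =>
        (hslice ε (hsub hε)).analyticOrderAt_ne_top_of_isPreconnected
          (convex_ball k₀ R₁).isPreconnected (hcb₁ (sphere_subset_closedBall hw)) (hcb₁ hz) hordw
    refine ⟨s, u, fun a ha => ?_, hu, hu0, hprod⟩
    rcases (mem_closedBall.1 (hs a ha)).lt_or_eq with h | h
    · exact h
    · refine absurd ?_ (hsphere ε hε a h)
      rw [hprod a, Multiset.prod_eq_zero (Multiset.mem_map.2 ⟨a, ha, sub_self a⟩), zero_mul]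
  choose! S u hSball hu hu0 hprod using hfactor
  -- the power sums of the zeros depend holomorphically on the parameter
  have hpow : ∀ m, DifferentiableOn ℂ (fun ε => ((S ε).map fun a => (a - k₀) ^ m).sum)
      (ball (0 : ℂ) δ₂) := by
    intro m
    set Ψ : ℂ × ℂ → ℂ := fun q => (q.2 - k₀) ^ m * (fderiv ℂ G q (0, 1) / G q) with hΨ
    have hΨan : ∀ ε ∈ ball (0 : ℂ) δ₂, ∀ z ∈ sphere k₀ r, AnalyticAt ℂ Ψ (ε, z) := by
      intro ε hε z hz
      have hGz := hGan ε (hsub hε) z (hcb₁ (sphere_subset_closedBall hz))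
      exact ((analyticAt_snd.sub analyticAt_const).pow m).mul
        ((analyticAt_clm_apply hGz.fderiv analyticAt_const).div hGz (hsphere ε hε z hz))
    have hdiff := (differentiableOn_circleIntegral isOpen_ball hr.le hΨan).const_mul
      (2 * Real.pi * Complex.I : ℂ)⁻¹
    refine hdiff.congr fun ε hε => ?_
    have hfun : (fun z => G (ε, z)) = fun z => ((S ε).map fun a => z - a).prod * u ε z :=
      funext (hprod ε hε)
    have hres := circleIntegral_pow_mul_logDeriv hr hcb₁ (hu ε hε) (hu0 ε hε) m (S ε) (hSball ε hε)
    rw [← hfun] at hres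
    have hcongr : EqOn (fun z => Ψ (ε, z))
        (fun z => (z - k₀) ^ m * logDeriv (fun z => G (ε, z)) z) (sphere k₀ r) := by
      intro z hz
      have h1 : HasDerivAt (fun z : ℂ => (ε, z)) ((0 : ℂ), (1 : ℂ)) z :=
        (hasDerivAt_const z ε).prodMk (hasDerivAt_id z)
      have h2 : HasDerivAt (fun z : ℂ => G (ε, z)) (fderiv ℂ G (ε, z) (0, 1)) z :=
        (hGan ε (hsub hε) z
          (hcb₁ (sphere_subset_closedBall hz))).differentiableAt.hasFDerivAt.comp_hasDerivAt z h1
      simp only [hΨ, logDeriv_apply, h2.deriv]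
    rw [circleIntegral.integral_congr hr.le hcongr, hres, inv_mul_cancel_left₀]
    simp [Real.pi_ne_zero]
  -- the zeros of `G (0, ·)`
  have h0δ₂ : (0 : ℂ) ∈ ball (0 : ℂ) δ₂ := mem_ball_self hδ₂
  have hS0 : S 0 = Multiset.replicate p k₀ := by
    have hall : ∀ a ∈ S 0, a = k₀ := by
      intro a ha
      by_contra hne
      refine hiso a (hcb₂ (ball_subset_closedBall (hSball 0 h0δ₂ a ha))) hne ?_
      rw [hprod 0 h0δ₂ a, Multiset.prod_eq_zero (Multiset.mem_map.2 ⟨a, ha, sub_self a⟩), zero_mul]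
    have hrep := Multiset.eq_replicate_card.2 hall
    have hcard : analyticOrderAt (fun k => G (0, k)) k₀ = Multiset.card (S 0) := by
      refine (hslice 0 h0δ k₀ hk₀R).analyticOrderAt_eq_natCast.2
        ⟨u 0, hu 0 h0δ₂ k₀ hk₀R, hu0 0 h0δ₂ k₀ (mem_closedBall_self hr.le),
          Eventually.of_forall fun z => ?_⟩
      have := hprod 0 h0δ₂ z
      rw [hrep] at this
      simpa using this
    have : Multiset.card (S 0) = p := by
      rw [hord] at hcard
      exact_mod_cast hcard.symm
    rw [hrep, this]
  -- the number of zeros is continuous in the parameter and integer-valued, so locally constant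
  obtain ⟨δ, hδ, hδ₂', hcard⟩ : ∃ δ > 0, δ ≤ δ₂ ∧ ∀ ε ∈ ball (0 : ℂ) δ,
      Multiset.card (S ε) = p := by
    have hcont : ContinuousAt (fun ε => ((S ε).map fun a => (a - k₀) ^ 0).sum) 0 :=
      ((hpow 0).differentiableAt (isOpen_ball.mem_nhds h0δ₂)).continuousAt
    simp only [pow_zero, Multiset.map_const', Multiset.sum_replicate, nsmul_eq_mul,
      mul_one] at hcont
    have hev : ∀ᶠ ε in 𝓝 (0 : ℂ), Multiset.card (S ε) = p := by
      have := Metric.continuousAt_iff'.1 hcont 1 one_pos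
      filter_upwards [this] with ε hε
      have h1 : dist (Multiset.card (S ε)) (Multiset.card (S 0)) < 1 := by
        rw [Complex.dist_eq] at hε
        rw [Nat.dist_eq]
        have : ((Multiset.card (S ε) : ℂ) - (Multiset.card (S 0) : ℂ)) =
            (((Multiset.card (S ε) : ℝ) - (Multiset.card (S 0) : ℝ) : ℝ) : ℂ) := by push_cast; rfl
        rwa [this, Complex.norm_real] at hε
      have h2 : Multiset.card (S ε) = Multiset.card (S 0) := by
        rw [Nat.dist_eq] at h1
        have h3 : |((Multiset.card (S ε) : ℤ) - (Multiset.card (S 0) : ℤ))| < 1 := by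
          exact_mod_cast h1
        have := Int.abs_lt_one_iff.1 h3
        omega
      rw [h2, hS0, Multiset.card_replicate]
    obtain ⟨δ, hδ, h⟩ := Metric.mem_nhds_iff.1 hev
    exact ⟨min δ δ₂, lt_min hδ hδ₂, min_le_right _ _,
      fun ε hε => h (ball_subset_ball (min_le_left _ _) hε)⟩
  have hsub' : ball (0 : ℂ) δ ⊆ ball 0 δ₂ := ball_subset_ball hδ₂'
  have hpoly : ∀ ε ∈ ball (0 : ℂ) δ, weierstrassPolynomial k₀ p
      (fun j => (-1) ^ (p - (j : ℕ)) * ((S ε).map fun a => a - k₀).esymm (p - j)) =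
      ((S ε).map fun a => Polynomial.X - Polynomial.C a).prod := fun ε hε =>
    weierstrassPolynomial_esymm_eq_prod k₀ (hcard ε hε)
  refine ⟨ball 0 δ, ball k₀ r,
    fun j ε => (-1) ^ (p - (j : ℕ)) * ((S ε).map fun a => a - k₀).esymm (p - j),
    isOpen_ball, mem_ball_self hδ, isOpen_ball, mem_ball_self hr,
    fun q hq => (hball (mk_mem_prod (hsub (hsub' hq.1)) (hcb₁ (ball_subset_closedBall hq.2)))).1,
    fun j => ?_, fun j => ?_, fun ε hε => ?_, fun ε hε k hk => ?_⟩
  · refine DifferentiableOn.const_mul (differentiableOn_multiset_esymm (fun m => ?_) _) _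
    simpa only [Multiset.map_map, Function.comp_def] using (hpow m).mono hsub'
  · have hj : 0 < p - (j : ℕ) := Nat.sub_pos_of_lt j.2
    simp only [hS0, Multiset.map_replicate, sub_self, mul_eq_zero]
    right
    refine Multiset.sum_eq_zero fun x hx => ?_
    obtain ⟨t, ht, rfl⟩ := Multiset.mem_map.1 hx
    rw [Multiset.mem_powersetCard] at ht
    obtain ⟨b, hb⟩ := Multiset.card_pos_iff_exists_mem.1 (ht.2 ▸ hj)
    exact Multiset.prod_eq_zero (Multiset.eq_of_mem_replicate (Multiset.mem_of_le ht.1 hb) ▸ hb)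
  · classical
    rw [hpoly ε hε, zerosIn, Polynomial.roots_multiset_prod_X_sub_C,
      Multiset.filter_eq_self.2 (hSball ε (hsub' hε)), hcard ε hε]
  · rw [hpoly ε hε, hprod ε (hsub' hε) k, mul_eq_zero,
      or_iff_left (hu0 ε (hsub' hε) k (ball_subset_closedBall hk)), Polynomial.IsRoot.def,
      Polynomial.eval_multiset_prod, Multiset.map_map]
    simp

end HolFredholm

open Filter Topology Set

/-! ### Perturbation of an eigenvalue of geometric multiplicity one -/

theorem mainTheorem2
    {X Y : Type*} [NormedAddCommGroup X] [NormedSpace ℂ X] [CompleteSpace X]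
    [NormedAddCommGroup Y] [NormedSpace ℂ Y] [CompleteSpace Y]
    (Λ : Set ℂ) (hΛo : IsOpen Λ) (hΛc : IsConnected Λ)
    (A : ℂ → X →L[ℂ] Y) (hA : HolFredholm.IsHolomorphicFredholm Λ A)
    (k₀ : ℂ) (hk₀ : HolFredholm.IsEigenvalue Λ A k₀)
    (hm : HolFredholm.geometricMultiplicity A k₀ = 1)
    (B : X →L[ℂ] Y) (hB : B ≠ 0)
    (p : ℕ) (hp : p = HolFredholm.algebraicMultiplicity A k₀) :
    ∃ (V Λ₀ : Set ℂ) (c : Fin p → ℂ → ℂ),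
      IsOpen V ∧ (0 : ℂ) ∈ V ∧ IsOpen Λ₀ ∧ k₀ ∈ Λ₀ ∧ Λ₀ ⊆ Λ ∧
      (∀ j, DifferentiableOn ℂ (c j) V) ∧
      (∀ j, c j 0 = 0) ∧
      (∀ ε ∈ V,
        HolFredholm.zerosIn
          (HolFredholm.weierstrassPolynomial k₀ p (fun j => c j ε)) Λ₀ = p) ∧
      (∀ ε ∈ V, ∀ k ∈ Λ₀,
        HolFredholm.IsEigenvalue Λ (fun z => A z + ε • B) k ↔
          (HolFredholm.weierstrassPolynomial k₀ p (fun j => c j ε)).IsRoot k) := by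
  have hk : k₀ ∈ Λ := hk₀.1
  have hAan : AnalyticAt ℂ A k₀ := hA.analyticAt hΛo hk
  obtain ⟨f, y, hM⟩ :=
    (hA.isInvertibleModFinite hΛc hk).exists_isInvertible_add_smulRight hm
  set M : ℂ × ℂ → X →L[ℂ] Y := fun q => A q.2 + q.1 • B + f.smulRight y with hMdef
  have hMan : AnalyticAt ℂ M (0, k₀) :=
    ((AnalyticAt.comp (g := A) (f := Prod.snd) hAan analyticAt_snd).add
      (analyticAt_fst.smul analyticAt_const)).add analyticAt_const
  have hM₀ : (M (0, k₀)).IsInvertible := by simpa [hMdef] using hM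
  set G : ℂ × ℂ → ℂ := fun q => 1 - f ((M q).inverse y) with hGdef
  have hGan : AnalyticAt ℂ G (0, k₀) :=
    analyticAt_const.sub ((f.analyticAt _).comp
      (HolFredholm.analyticAt_clm_apply (HolFredholm.analyticAt_inverse_clm hMan hM₀)
        analyticAt_const))
  have hG0 : (fun k => G (0, k)) = fun z => 1 - f ((A z + f.smulRight y).inverse y) := by
    funext z
    simp [hGdef, hMdef]
  -- where `M` is invertible, the eigenvalues of `A + ε B` are the zeros of `G (ε, ·)`
  have hMev : ∀ᶠ q in 𝓝 ((0, k₀) : ℂ × ℂ), (M q).IsInvertible ∧ q.2 ∈ Λ :=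
    (hMan.continuousAt.eventually (HolFredholm.isOpen_isInvertible.mem_nhds hM₀)).and
      (continuous_snd.continuousAt.eventually (hΛo.mem_nhds hk))
  have hiff : ∀ q : ℂ × ℂ, (M q).IsInvertible →
      (¬ Function.Injective (A q.2 + q.1 • B) ↔ G q = 0) := fun q hq =>
    HolFredholm.not_injective_iff_of_isInvertible_add_smulRight hq
  have hG₀ : G (0, k₀) = 0 := (hiff _ hM₀).1 (by simpa using hk₀.2)
  have hslice : AnalyticAt ℂ (fun k => G (0, k)) k₀ :=
    AnalyticAt.comp (g := G) (f := fun z => ((0 : ℂ), z)) hGan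
      (analyticAt_const.prod analyticAt_id)
  -- eigenvalues of `A` are isolated, so `G (0, ·)` does not vanish identically
  have hne : analyticOrderAt (fun k => G (0, k)) k₀ ≠ ⊤ := by
    intro htop
    have hc : ContinuousAt (fun z : ℂ => ((0 : ℂ), z)) k₀ := by fun_prop
    have h1 : ∀ᶠ z in 𝓝[≠] k₀, (A z).IsInvertible ∧ G (0, z) = 0 ∧ (M (0, z)).IsInvertible :=
      (hA.eventually_isInvertible hΛo hΛc hk).and (((analyticOrderAt_eq_top.1 htop).and
        ((hc.eventually hMev).mono fun _ h => h.1)).filter_mono nhdsWithin_le_nhds)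
    obtain ⟨z, hz, hGz, hMz⟩ := h1.exists
    exact (hiff (0, z) hMz).2 hGz (by simpa using hz.injective)
  obtain ⟨n, hn⟩ := ENat.ne_top_iff_exists.1 hne
  have hn1 : 1 ≤ n := by
    rw [Nat.one_le_iff_ne_zero]
    rintro rfl
    exact hslice.analyticOrderAt_eq_zero.1 hn.symm hG₀
  obtain rfl : p = n := hp.trans
    (HolFredholm.algebraicMultiplicity_eq_of_analyticOrderAt_eq hAan hM hm hn1 (hG0 ▸ hn.symm))
  obtain ⟨V, Λ₀, c, hVo, h0V, hΛ₀o, hkΛ₀, hsub, hc, hc0, hcount, hroots⟩ :=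
    HolFredholm.exists_weierstrassPolynomial hGan hn.symm hMev
  refine ⟨V, Λ₀, c, hVo, h0V, hΛ₀o, hkΛ₀, fun k hk => (hsub (mk_mem_prod h0V hk)).2, hc, hc0,
    hcount, fun ε hε k hk => ?_⟩
  obtain ⟨hMk, hkΛ⟩ := hsub (mk_mem_prod hε hk)
  rw [← hroots ε hε k hk, ← hiff (ε, k) hMk, HolFredholm.IsEigenvalue]
  exact and_iff_right hkΛ
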